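/- Let $B\subseteq\mathbb{R}^k$ be a domain and let $\pi:\mathcal{X}\to B$ be a differentiable family of compact complex $n$-dimensional manifolds. That is: $\mathcal{X}$ is a smooth manifold; $\pi$ is a smooth map of $\mathcal{X}$ onto $B$ whose Jacobian has rank $k$ at every point; each fiber $\pi^{-1}(t)$ is compact and connected and is the underlying smooth manifold of a complex $n$-dimensional manifold $X_t$; and there are a locally finite open covering $\{\mathcal{U}_j\}_{j\ge1}$ of $\mathcal{X}$ and smooth maps $\zeta_j=(\zeta_j^1,\dots,\zeta_j^n):\mathcal{U}_j\to\mathbb{C}^n$ such that, for each $t\in B$, the restrictions $\zeta_j|_{\mathcal{U}_j\cap\pi^{-1}(t)}$ with $\mathcal{U}_j\cap\pi^{-1}(t)\neq\emptyset$ form a system of local holomorphic coordinates of $X_t$. Let $0\le p\le n$ and $q=n-p$. A $(p,p)$-form $\Xi$ on a complex vector space $V$ of dimension $n$ is called transverse if, for every nonzero decomposable $(q,0)$-form $\tau=\gamma_1\wedge\cdots\wedge\gamma_q$ with $\gamma_i\in V^*$, the form $\Xi\wedge\sigma_q\,\tau\wedge\bar\tau$, where $\sigma_q=2^{-q}(\sqrt{-1})^{q^2}$,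 is a strictly positive volume form, that is, equals $c\,\sigma_n\,\beta_1\wedge\cdots\wedge\beta_n\wedge\bar\beta_1\wedge\cdots\wedge\bar\beta_n$ for some basis $\beta_1,\dots,\beta_n$ of $V^*$ and some real $c>0$. A $(p,p)$-form on a complex manifold is transverse if it is transverse on the tangent space at every point. For $t\in B$ let $\Omega_t$ be a real $(p,p)$-form on $X_t$, depending smoothly on $t$: on each $\mathcal{U}_j$, the coefficients of $\Omega_t$ with respect to the coordinates $\zeta_j$ are smooth functions on $\mathcal{U}_j$, i.e. smooth jointly in $(\zeta_j,t)$. Let $t_0\in B$ and assume that $\Omega_{t_0}$ is transverse on $X_{t_0}$. Then there is $\varepsilon>0$ such that $\Omega_t$ is transverse on $X_t$ for all $t\in B$ with $|t-t_0|<\varepsilon$. -/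

import Mathlib

open scoped Manifold ContDiff Topology

noncomputable section

/-! ### Complex-valued forms on a complex vector space -/

/-- The complexified space of exterior `m`-forms of a complex vector space `V`:
`ℝ`-multilinear alternating maps in `m` vectors of `V`, with values in `ℂ`. -/
abbrev CForm (V : Type*) [AddCommGroup V] [Module ℂ V] (m : ℕ) : Type _ :=
  V [⋀^Fin m]→ₗ[ℝ] ℂ

namespace CForm

variable {V W : Type*} [AddCommGroup V] [Module ℂ V] [AddCommGroup W] [Module ℂ W]

/-- The exterior product
`(a ∧ b) (v₁, …, v_{r+s}) = ∑ sign(σ) a (v_{σ 1}, …, v_{σ r}) b (v_{σ (r+1)}, …, v_{σ (r+s)})`,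
the sum being over the `(r, s)`-shuffles `σ`. -/
def wedge {r s : ℕ} (a : CForm V r) (b : CForm V s) : CForm V (r + s) :=
  ((LinearMap.mul' ℝ ℂ).compAlternatingMap (a.domCoprod b)).domDomCongr finSumFinEquiv

/-- The complex conjugate of a form. -/
def conj {m : ℕ} (a : CForm V m) : CForm V m :=
  Complex.conjAe.toLinearMap.compAlternatingMap a

/-- Pull-back of a form along a complex linear map. -/
def pullback {m : ℕ} (L : V →ₗ[ℂ] W) (a : CForm W m) : CForm V m :=
  a.compLinearMap (L.restrictScalars ℝ)

/-- The decomposable `(q, 0)`-form `γ₁ ∧ ⋯ ∧ γ_q`, where the `γᵢ` are complex linear functionals: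
`(v₁, …, v_q) ↦ ∑_σ sign(σ) ∏ᵢ γᵢ (v_{σ i}) = det (γᵢ (vⱼ))`. -/
def decomposable {q : ℕ} (γ : Fin q → Module.Dual ℂ V) : CForm V q :=
  MultilinearMap.alternatization
    ((MultilinearMap.mkPiAlgebra ℝ (Fin q) ℂ).compLinearMap fun i ↦ (γ i).restrictScalars ℝ)

variable (V) in
/-- The space `⋀^{r,s} V^*` of `(r, s)`-forms: the complex span of the forms
`γ₁ ∧ ⋯ ∧ γ_r ∧ δ̄₁ ∧ ⋯ ∧ δ̄_s` with complex linear functionals `γᵢ`, `δⱼ`. -/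
def ofType (r s : ℕ) : Submodule ℂ (CForm V (r + s)) :=
  Submodule.span ℂ
    {a | ∃ (γ : Fin r → Module.Dual ℂ V) (δ : Fin s → Module.Dual ℂ V),
      a = wedge (decomposable γ) (conj (decomposable δ))}

/-- A form is real if it is invariant under conjugation. -/
def IsReal {m : ℕ} (a : CForm V m) : Prop := conj a = a

/-- The constant `σ_q = 2^{-q} (√-1)^{q²}`. -/
def sigma (q : ℕ) : ℂ := ((2 : ℂ) ^ q)⁻¹ * Complex.I ^ (q ^ 2)

/-- A form of top degree is a strictly positive volume form if it is
`c σ_n β₁ ∧ ⋯ ∧ β_n ∧ β̄₁ ∧ ⋯ ∧ β̄_n` for a real number `c > 0` and a basis `β₁, …, β_n` of the space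
of complex linear functionals. -/
def IsStrictlyPositiveVolume {m : ℕ} (Θ : CForm V m) : Prop :=
  ∃ (n : ℕ) (h : n + n = m) (β : Module.Basis (Fin n) ℂ (Module.Dual ℂ V)) (c : ℝ), 0 < c ∧
    Θ = (((c : ℂ) * sigma n) • wedge (decomposable β) (conj (decomposable β))).domDomCongr
      (finCongr h)

/-- A `(p, p)`-form `Ω` on an `n`-dimensional complex vector space is transverse if, for
`q = n - p`, the form `Ω ∧ σ_q τ ∧ τ̄` is a strictly positive volume form for every nonzero
decomposable `(q, 0)`-form `τ`. -/
def IsTransverse {p : ℕ} (Ω : CForm V (p + p)) : Prop :=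
  Ω ∈ ofType V p p ∧
    ∀ q : ℕ, p + q = Module.finrank ℂ V → ∀ γ : Fin q → Module.Dual ℂ V, decomposable γ ≠ 0 →
      IsStrictlyPositiveVolume
        (wedge Ω (sigma q • wedge (decomposable γ) (conj (decomposable γ))))

end CForm

/-! ### Forms on complex manifolds -/

section ComplexManifold

variable {n : ℕ} {M : Type*} [TopologicalSpace M] [ChartedSpace (EuclideanSpace ℂ (Fin n)) M]

variable (n M) in
/-- Complex-valued differential forms of degree `m` on an `n`-dimensional complex manifold `M`
(not necessarily smooth). -/
abbrev FormField (m : ℕ) : Type _ :=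
  ∀ x : M, CForm (TangentSpace 𝓘(ℂ, EuclideanSpace ℂ (Fin n)) x) m

/-- A differential form of type `(p, p)` that is real. -/
def IsRealPPForm {p : ℕ} (Ω : FormField n M (p + p)) : Prop :=
  ∀ x : M, Ω x ∈ CForm.ofType (TangentSpace 𝓘(ℂ, EuclideanSpace ℂ (Fin n)) x) p p ∧ (Ω x).IsReal

/-- A differential form of type `(p, p)` that is transverse at each point. -/
def IsTransverseForm {p : ℕ} (Ω : FormField n M (p + p)) : Prop :=
  ∀ x : M, (Ω x).IsTransverse

end ComplexManifold

/-! ### Differentiable families of compact complex manifolds -/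

/-- A differentiable family `π : 𝒳 → B` of `n`-dimensional compact complex manifolds over a domain
`B` of `ℝ^k`. Here `𝒳` is a smooth manifold of (real) dimension `m`. -/
structure DifferentiableFamily (n k m : ℕ) (𝒳 : Type*) [TopologicalSpace 𝒳]
    [ChartedSpace (EuclideanSpace ℝ (Fin m)) 𝒳] (B : Set (EuclideanSpace ℝ (Fin k))) where
  isOpen_base : IsOpen B
  isConnected_base : IsConnected B
  /-- The smooth map `π` of `𝒳` onto `B`. -/
  proj : 𝒳 → EuclideanSpace ℝ (Fin k)
  contMDiff_proj : ContMDiff (𝓡 m) (𝓡 k) ∞ proj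
  range_proj : Set.range proj = B
  /-- The Jacobian of `π` has rank `k` everywhere. -/
  submersion : ∀ x : 𝒳, Function.Surjective (mfderiv (𝓡 m) (𝓡 k) proj x)
  isCompact_fiber : ∀ t ∈ B, IsCompact (proj ⁻¹' {t})
  isConnected_fiber : ∀ t ∈ B, IsConnected (proj ⁻¹' {t})
  /-- Each fiber is a complex manifold `X_t` of dimension `n`. -/
  [chartedSpace_fiber : ∀ t, ChartedSpace (EuclideanSpace ℂ (Fin n)) ↥(proj ⁻¹' {t})]
  [isManifold_fiber : ∀ t, IsManifold 𝓘(ℂ, EuclideanSpace ℂ (Fin n)) ω ↥(proj ⁻¹' {t})]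
  /-- The smooth manifold underlying `X_t` is the submanifold `π⁻¹(t)` of `𝒳`. -/
  isSmoothEmbedding_fiber : ∀ t, Manifold.IsSmoothEmbedding
    𝓘(ℝ, EuclideanSpace ℂ (Fin n)) (𝓡 m) ∞ (Subtype.val : ↥(proj ⁻¹' {t}) → 𝒳)
  /-- The members `𝒰_j` of a locally finite open covering of `𝒳`. -/
  cover : ℕ → Set 𝒳
  isOpen_cover : ∀ j, IsOpen (cover j)
  locallyFinite_cover : LocallyFinite cover
  iUnion_cover : ⋃ j, cover j = Set.univ
  /-- The smooth functions `(ζ_j^1, …, ζ_j^n)` on `𝒰_j`. -/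
  coord : ℕ → 𝒳 → EuclideanSpace ℂ (Fin n)
  contMDiffOn_coord : ∀ j,
    ContMDiffOn (𝓡 m) 𝓘(ℝ, EuclideanSpace ℂ (Fin n)) ∞ (coord j) (cover j)
  /-- For each `t`, the restrictions of the `ζ_j` to the sets `𝒰_j ∩ π⁻¹(t) ≠ ∅` are local
  holomorphic coordinates of `X_t`. -/
  coord_fiber : ∀ t j, (cover j ∩ proj ⁻¹' {t}).Nonempty →
    ∃ e ∈ IsManifold.maximalAtlas 𝓘(ℂ, EuclideanSpace ℂ (Fin n)) ω ↥(proj ⁻¹' {t}),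
      e.source = Subtype.val ⁻¹' cover j ∧ ∀ x ∈ e.source, e x = coord j (x : 𝒳)

namespace DifferentiableFamily

attribute [instance] DifferentiableFamily.chartedSpace_fiber
  DifferentiableFamily.isManifold_fiber

variable {n k m : ℕ} {𝒳 : Type*} [TopologicalSpace 𝒳] [ChartedSpace (EuclideanSpace ℝ (Fin m)) 𝒳]
  {B : Set (EuclideanSpace ℝ (Fin k))}

/-- The fiber `X_t = π⁻¹(t)` over a point `t`, a complex manifold of dimension `n`
(empty if `t ∉ B`). -/
abbrev Fiber (F : DifferentiableFamily n k m 𝒳 B) (t : EuclideanSpace ℝ (Fin k)) : Type _ :=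
  ↥(F.proj ⁻¹' {t})

/-- The differential at `x ∈ X_t` of the functions `ζ_j` restricted to the complex manifold
`X_t`. -/
def dcoord (F : DifferentiableFamily n k m 𝒳 B) (j : ℕ) {t : EuclideanSpace ℝ (Fin k)}
    (x : F.Fiber t) :
    TangentSpace 𝓘(ℂ, EuclideanSpace ℂ (Fin n)) x →ₗ[ℂ] EuclideanSpace ℂ (Fin n) :=
  (mfderiv 𝓘(ℂ, EuclideanSpace ℂ (Fin n)) 𝓘(ℂ, EuclideanSpace ℂ (Fin n))
    (fun y : F.Fiber t ↦ F.coord j (y : 𝒳)) x).toLinearMap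

/-- A family of differential forms `Ω_t` on the fibers `X_t` depends smoothly on `t` if, in each
coordinate system `ζ_j` of the family, it is a form in the differentials of `ζ_j` and of its
conjugate whose coefficients are smooth functions on the open subset `𝒰_j` of `𝒳`, that is, are
smooth in all of `(ζ_j, t)`. -/
def IsSmoothFamily (F : DifferentiableFamily n k m 𝒳 B) {d : ℕ}
    (Ω : ∀ t, FormField n (F.Fiber t) d) : Prop :=
  ∀ j, ∃ a : 𝒳 → CForm (EuclideanSpace ℂ (Fin n)) d,
    (∀ v : Fin d → EuclideanSpace ℂ (Fin n),
      ContMDiffOn (𝓡 m) 𝓘(ℝ, ℂ) ∞ (fun x ↦ a x v) (F.cover j)) ∧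
    ∀ (t : EuclideanSpace ℝ (Fin k)) (x : F.Fiber t), (x : 𝒳) ∈ F.cover j →
      Ω t x = CForm.pullback (F.dcoord j x) (a (x : 𝒳))

end DifferentiableFamily

end

/-! Transversality of a real `(p, p)`-form is an open condition, and compactness of the central fiber
makes it uniform.

*Linear algebra.* On `ℂ^n` the exterior product of `γ₁ ∧ ⋯ ∧ γ_r` and `δ̄₁ ∧ ⋯ ∧ δ̄_s` is the
determinant of the rows `γᵢ` and `δ̄ⱼ` (`CForm.wedge_decomposable_conj_apply`). Hence
`σ_q τ ∧ τ̄` is real (`CForm.isReal_hermitianSquare`), and for `q = n` and a basis it does not vanish,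
so it spans the forms of top degree. A real form `Ω` of type `(p, p)` therefore has a real ratio of
`Ω ∧ σ_q τ ∧ τ̄` to the standard volume form, and it is transverse if and only if these ratios are
positive. A nonzero decomposable `τ` is a nonzero multiple `z τ'` of one built from an orthonormal
family (`CForm.exists_orthonormal_decomposable_eq_smul`), which only multiplies the ratio by `|z|²`.
So transversality is a strict inequality for a continuous function on the compact set of orthonormal
families, and it persists under small changes of the coefficients
(`CForm.IsTransverse.eventually`).

*Geometry.* In the coordinates `ζ_j` the forms `Ω_t` are pull-backs, along the isomorphisms `dζ_j`, of
forms on `ℂ^n` that depend continuously on the point of `𝒳`. Hence `Ω` is transverse at all points of a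
neighbourhood of `X_{t₀}` in `𝒳`. No properness of `π` is assumed, but since the fibers are compact
and connected and `π` is a submersion, any neighbourhood of `X_{t₀}` contains all fibers near it
(`DifferentiableFamily.eventually_fiber_subset`). -/

noncomputable section

/-! ### Exterior products and decomposable forms -/

namespace CForm

variable {V W : Type*} [AddCommGroup V] [Module ℂ V] [AddCommGroup W] [Module ℂ W]

@[simp]
theorem conj_apply {m : ℕ} (a : CForm V m) (v : Fin m → V) : conj a v = (starRingEnd ℂ) (a v) :=
  rfl

@[simp]
theorem pullback_apply {m : ℕ} (L : V →ₗ[ℂ] W) (a : CForm W m) (v : Fin m → V) :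
    pullback L a v = a fun i ↦ L (v i) :=
  rfl

/-- The shuffle formula for the wedge product, with an arbitrary representative chosen in each
class of permutations modulo permutations of the two blocks. -/
theorem wedge_apply {r s : ℕ} (a : CForm V r) (b : CForm V s) (v : Fin (r + s) → V) :
    wedge a b v = ∑ τ : Equiv.Perm.ModSumCongr (Fin r) (Fin s),
      ((Equiv.Perm.sign τ.out : ℤ) : ℂ) *
        (a (fun i ↦ v (finSumFinEquiv (τ.out (.inl i)))) *
          b (fun i ↦ v (finSumFinEquiv (τ.out (.inr i))))) := by
  simp only [wedge, AlternatingMap.domDomCongr_apply, LinearMap.compAlternatingMap_apply,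
    AlternatingMap.domCoprod_apply, sum_apply, map_sum]
  refine Finset.sum_congr rfl fun τ _ ↦ ?_
  conv_lhs => rw [← Quotient.out_eq' τ, AlternatingMap.domCoprod.summand_mk'']
  rcases Int.units_eq_one_or (Equiv.Perm.sign τ.out) with h | h <;>
    simp [h, MultilinearMap.domCoprod_apply, Function.comp_def]

theorem pullback_wedge {r s : ℕ} (L : V →ₗ[ℂ] W) (a : CForm W r) (b : CForm W s) :
    pullback L (wedge a b) = wedge (pullback L a) (pullback L b) := by
  ext v; simp [wedge_apply]

theorem conj_wedge {r s : ℕ} (a : CForm V r) (b : CForm V s) :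
    conj (wedge a b) = wedge (conj a) (conj b) := by
  ext v; simp [wedge_apply]

theorem smul_wedge {r s : ℕ} (c : ℂ) (a : CForm V r) (b : CForm V s) :
    wedge (c • a) b = c • wedge a b := by
  ext v; simp only [wedge_apply, AlternatingMap.smul_apply, smul_eq_mul, Finset.mul_sum]
  exact Finset.sum_congr rfl fun _ _ ↦ by ring

theorem wedge_smul {r s : ℕ} (c : ℂ) (a : CForm V r) (b : CForm V s) :
    wedge a (c • b) = c • wedge a b := by
  ext v; simp only [wedge_apply, AlternatingMap.smul_apply, smul_eq_mul, Finset.mul_sum]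
  exact Finset.sum_congr rfl fun _ _ ↦ by ring

theorem conj_smul {m : ℕ} (c : ℂ) (a : CForm V m) : conj (c • a) = (starRingEnd ℂ) c • conj a := by
  ext v; simp

theorem pullback_smul {m : ℕ} (L : V →ₗ[ℂ] W) (c : ℂ) (a : CForm W m) :
    pullback L (c • a) = c • pullback L a := by
  ext v; simp

theorem pullback_conj {m : ℕ} (L : V →ₗ[ℂ] W) (a : CForm W m) :
    pullback L (conj a) = conj (pullback L a) :=
  rfl

theorem continuous_wedge_apply {X : Type*} [TopologicalSpace X] {r s : ℕ} {a : X → CForm V r}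
    {b : X → CForm V s} (ha : ∀ v, Continuous fun x ↦ a x v) (hb : ∀ v, Continuous fun x ↦ b x v)
    (v : Fin (r + s) → V) : Continuous fun x ↦ wedge (a x) (b x) v := by
  simp only [wedge_apply]
  exact continuous_finsetSum _ fun τ _ ↦ continuous_const.mul ((ha _).mul (hb _))

theorem decomposable_apply {q : ℕ} (γ : Fin q → Module.Dual ℂ V) (v : Fin q → V) :
    decomposable γ v = (Matrix.of fun i j ↦ γ i (v j)).det := by
  rw [← Matrix.det_transpose, Matrix.det_apply, decomposable, MultilinearMap.alternatization_apply]
  rfl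

theorem pullback_decomposable {q : ℕ} (L : V →ₗ[ℂ] W) (γ : Fin q → Module.Dual ℂ W) :
    pullback L (decomposable γ) = decomposable fun i ↦ γ i ∘ₗ L := by
  ext v; simp [decomposable_apply]

theorem decomposable_eq_det_smul {q : ℕ} {γ δ : Fin q → Module.Dual ℂ V}
    {A : Matrix (Fin q) (Fin q) ℂ} (h : ∀ i, γ i = ∑ j, A i j • δ j) :
    decomposable γ = A.det • decomposable δ := by
  ext v
  simp only [decomposable_apply, AlternatingMap.smul_apply, smul_eq_mul, ← Matrix.det_mul]
  congr 1
  ext i j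
  simp [h, Matrix.mul_apply, LinearMap.sum_apply]

theorem linearIndependent_of_decomposable_ne_zero {q : ℕ} {γ : Fin q → Module.Dual ℂ V}
    (h : decomposable γ ≠ 0) : LinearIndependent ℂ γ := by
  obtain ⟨v, hv⟩ : ∃ v, decomposable γ v ≠ 0 := by
    by_contra! h'
    exact h (by ext v; simpa using h' v)
  rw [decomposable_apply] at hv
  let ev : Module.Dual ℂ V →ₗ[ℂ] (Fin q → ℂ) := LinearMap.pi fun j ↦ LinearMap.applyₗ (v j)
  exact LinearIndependent.of_comp ev (Matrix.linearIndependent_rows_of_det_ne_zero hv)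

/-- The value of `γ₁ ∧ ⋯ ∧ γ_q ∧ δ̄₁ ∧ ⋯ ∧ δ̄_s` is a determinant, because the wedge product of two
alternatizations is the alternatization of the tensor product. -/
theorem wedge_decomposable_conj_apply {r s : ℕ} (γ : Fin r → Module.Dual ℂ V)
    (δ : Fin s → Module.Dual ℂ V) (v : Fin (r + s) → V) :
    wedge (decomposable γ) (conj (decomposable δ)) v =
      (Matrix.of fun i j : Fin r ⊕ Fin s ↦
        Sum.elim (fun k ↦ γ k (v (finSumFinEquiv j)))
          (fun k ↦ (starRingEnd ℂ) (δ k (v (finSumFinEquiv j)))) i).det := by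
  have hδ : conj (decomposable δ) = MultilinearMap.alternatization
      ((MultilinearMap.mkPiAlgebra ℝ (Fin s) ℂ).compLinearMap fun i ↦
        Complex.conjAe.toLinearMap ∘ₗ (δ i).restrictScalars ℝ) := by
    ext v
    rw [conj_apply, decomposable_apply, ← Matrix.det_transpose, Matrix.det_apply, map_sum,
      MultilinearMap.alternatization_apply]
    refine Finset.sum_congr rfl fun σ _ ↦ ?_
    rcases Int.units_eq_one_or (Equiv.Perm.sign σ) with h | h <;> simp [h]
  rw [hδ, wedge, decomposable, ← MultilinearMap.domCoprod_alternization]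
  rw [← Matrix.det_transpose, Matrix.det_apply, AlternatingMap.domDomCongr_apply,
    LinearMap.compAlternatingMap_apply, MultilinearMap.alternatization_apply, map_sum]
  refine Finset.sum_congr rfl fun σ _ ↦ ?_
  rcases Int.units_eq_one_or (Equiv.Perm.sign σ) with h | h <;>
    simp [h, MultilinearMap.domCoprod_apply]

/-- The real form `σ_q τ ∧ τ̄` of type `(q, q)` associated with `τ = γ₁ ∧ ⋯ ∧ γ_q`. -/
def hermitianSquare {q : ℕ} (γ : Fin q → Module.Dual ℂ V) : CForm V (q + q) :=
  sigma q • wedge (decomposable γ) (conj (decomposable γ))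

theorem pullback_hermitianSquare {q : ℕ} (L : V →ₗ[ℂ] W) (γ : Fin q → Module.Dual ℂ W) :
    pullback L (hermitianSquare γ) = hermitianSquare fun i ↦ γ i ∘ₗ L := by
  simp [hermitianSquare, pullback_smul, pullback_wedge, pullback_conj, pullback_decomposable]

theorem hermitianSquare_eq_normSq_smul {q : ℕ} {γ δ : Fin q → Module.Dual ℂ V} {z : ℂ}
    (h : decomposable γ = z • decomposable δ) :
    hermitianSquare γ = ((Complex.normSq z : ℝ) : ℂ) • hermitianSquare δ := by
  rw [hermitianSquare, h, conj_smul, smul_wedge, wedge_smul, hermitianSquare, smul_smul, smul_smul,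
    smul_smul, Complex.normSq_eq_conj_mul_self]
  congr 1
  ring

theorem sign_sumComm (q : ℕ) :
    Equiv.Perm.sign (Equiv.sumComm (Fin q) (Fin q) : Equiv.Perm (Fin q ⊕ Fin q)) = (-1) ^ q := by
  have h := Equiv.Perm.sign_eq_sign_of_equiv
    (Equiv.sumComm (Fin q) (Fin q) : Equiv.Perm (Fin q ⊕ Fin q))
    (Equiv.prodCongrLeft fun _ : Fin q ↦ Equiv.boolNot) (Equiv.boolProdEquivSum (Fin q)).symm
    (by rintro (i | i) <;> rfl)
  have h2 : Equiv.Perm.sign Equiv.boolNot = -1 := by decide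
  rw [h, Equiv.Perm.sign_prodCongrLeft]
  simp [h2]

theorem conj_sigma_mul (q : ℕ) : (starRingEnd ℂ) (sigma q) * (-1) ^ q = sigma q := by
  have h : ((-1 : ℂ)) ^ (q ^ 2) * (-1) ^ q = 1 := by
    rw [← pow_add, sq, ← Nat.mul_succ]
    exact (Nat.even_mul_succ_self q).neg_one_pow
  simp only [sigma, map_mul, map_inv₀, map_pow, Complex.conj_I, map_ofNat]
  rw [neg_pow, mul_assoc, mul_right_comm _ _ ((-1 : ℂ) ^ q), h, one_mul]

theorem isReal_hermitianSquare {q : ℕ} (γ : Fin q → Module.Dual ℂ V) :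
    (hermitianSquare γ).IsReal := by
  ext v
  simp only [hermitianSquare, conj_apply, AlternatingMap.smul_apply, smul_eq_mul, map_mul,
    wedge_decomposable_conj_apply]
  set M : Matrix (Fin q ⊕ Fin q) (Fin q ⊕ Fin q) ℂ := Matrix.of fun i j ↦
    Sum.elim (fun k ↦ γ k (v (finSumFinEquiv j)))
      (fun k ↦ (starRingEnd ℂ) (γ k (v (finSumFinEquiv j)))) i with hM
  -- Conjugation exchanges the two blocks of rows.
  have hconj : (starRingEnd ℂ).mapMatrix M =
      M.submatrix (Equiv.sumComm (Fin q) (Fin q) : Equiv.Perm (Fin q ⊕ Fin q)) id := by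
    ext (i | i) j <;> simp [hM]
  rw [RingHom.map_det, hconj, Matrix.det_permute, sign_sumComm, ← mul_assoc]
  push_cast
  rw [conj_sigma_mul]

theorem IsReal.wedge {r s : ℕ} {a : CForm V r} {b : CForm V s} (ha : a.IsReal) (hb : b.IsReal) :
    (CForm.wedge a b).IsReal := by
  rw [IsReal, conj_wedge, ha, hb]

/-! ### Forms of top degree -/

/-- The real basis `b₁, …, b_n, i b₁, …, i b_n` of a complex vector space with basis
`b₁, …, b_n`. -/
def realBasis {n : ℕ} (b : Module.Basis (Fin n) ℂ V) : Module.Basis (Fin (n + n)) ℝ V :=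
  (Complex.basisOneI.smulTower b).reindex
    ((finTwoEquiv.prodCongr (Equiv.refl _)).trans
      ((Equiv.boolProdEquivSum _).trans finSumFinEquiv))

theorem realBasis_inl {n : ℕ} (b : Module.Basis (Fin n) ℂ V) (i : Fin n) :
    realBasis b (finSumFinEquiv (.inl i)) = b i := by
  simp [realBasis, -finSumFinEquiv_apply_left, show finTwoEquiv.symm false = 0 from rfl]

theorem realBasis_inr {n : ℕ} (b : Module.Basis (Fin n) ℂ V) (i : Fin n) :
    realBasis b (finSumFinEquiv (.inr i)) = Complex.I • b i := by
  simp [realBasis, -finSumFinEquiv_apply_right, show finTwoEquiv.symm true = 1 from rfl]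

theorem eq_of_apply_realBasis {n : ℕ} (b : Module.Basis (Fin n) ℂ V) {Θ Θ' : CForm V (n + n)}
    (h : Θ (realBasis b) = Θ' (realBasis b)) : Θ = Θ' := by
  refine (realBasis b).ext_alternating fun v hv ↦ ?_
  let σ : Equiv.Perm (Fin (n + n)) := Equiv.ofBijective v (Finite.injective_iff_bijective.mp hv)
  have h1 := Θ.map_perm (realBasis b) σ
  have h2 := Θ'.map_perm (realBasis b) σ
  rw [h, ← h2] at h1
  exact h1

theorem sigma_ne_zero (q : ℕ) : sigma q ≠ 0 := by simp [sigma]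

theorem hermitianSquare_dualBasis_ne_zero {n : ℕ} (b : Module.Basis (Fin n) ℂ V) :
    hermitianSquare b.dualBasis (realBasis b) ≠ 0 := by
  rw [hermitianSquare, AlternatingMap.smul_apply, smul_eq_mul, wedge_decomposable_conj_apply]
  refine mul_ne_zero (sigma_ne_zero n) ?_
  -- On `b₁, …, b_n, i b₁, …, i b_n` the matrix is `[1, i; 1, -i]`.
  have : (Matrix.of fun i j : Fin n ⊕ Fin n ↦
        Sum.elim (fun k ↦ b.dualBasis k (realBasis b (finSumFinEquiv j)))
          (fun k ↦ (starRingEnd ℂ) (b.dualBasis k (realBasis b (finSumFinEquiv j)))) i) =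
      Matrix.fromBlocks 1 (Complex.I • 1) 1 (-Complex.I • 1) := by
    ext (i | i) (j | j) <;>
      simp only [Matrix.of_apply, Sum.elim_inl, Sum.elim_inr, realBasis_inl, realBasis_inr] <;>
      simp [Matrix.one_apply, Finsupp.single_apply, eq_comm, apply_ite]
  rw [this, Matrix.det_fromBlocks_one₁₁, Matrix.one_mul, ← sub_smul, Matrix.det_smul]
  simp only [Matrix.det_one, mul_one]
  refine pow_ne_zero _ fun h ↦ ?_
  have := congrArg Complex.im h
  norm_num at this

/-- Every basis of the dual gives the same positive volume forms, since a change of basis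
multiplies `τ ∧ τ̄` by the squared absolute value of its determinant. -/
theorem isStrictlyPositiveVolume_iff {n m : ℕ} (b : Module.Basis (Fin n) ℂ V) (h : n + n = m)
    (Θ : CForm V m) :
    IsStrictlyPositiveVolume Θ ↔ ∃ c : ℝ, 0 < c ∧
      Θ (realBasis b ∘ finCongr h.symm) = c * hermitianSquare b.dualBasis (realBasis b) := by
  subst h
  constructor
  · rintro ⟨n', h, β, c, hc, rfl⟩
    obtain rfl : n' = n := by omega
    set A : Matrix (Fin n') (Fin n') ℂ := (b.dualBasis.toMatrix β).transpose with hA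
    have hdet : A.det ≠ 0 := by
      rw [hA, Matrix.det_transpose]
      have := b.dualBasis.toMatrix_mul_toMatrix_flip β
      intro h0
      have h1 := congrArg Matrix.det this
      rw [Matrix.det_mul, h0, zero_mul, Matrix.det_one] at h1
      exact zero_ne_one h1
    have hβ : decomposable β = A.det • decomposable b.dualBasis :=
      decomposable_eq_det_smul fun i ↦ (b.dualBasis.sum_toMatrix_smul_self β i).symm
    refine ⟨c * Complex.normSq A.det, mul_pos hc (Complex.normSq_pos.mpr hdet), ?_⟩
    have := hermitianSquare_eq_normSq_smul hβ
    rw [mul_smul]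
    change ((c : ℂ) • hermitianSquare β) (realBasis b) = _
    rw [this]
    simp [mul_assoc]
  · rintro ⟨c, hc, h⟩
    refine ⟨n, rfl, b.dualBasis, c, hc, eq_of_apply_realBasis b ?_⟩
    rw [mul_smul]
    exact h

/-- A real form of top degree is a real multiple of a given volume form, so that positivity is an
open condition on it. -/
theorem IsReal.isStrictlyPositiveVolume_iff {n m : ℕ} (b : Module.Basis (Fin n) ℂ V)
    (h : n + n = m) {Θ : CForm V m} (hΘ : Θ.IsReal) :
    IsStrictlyPositiveVolume Θ ↔ 0 < (Θ (realBasis b ∘ finCongr h.symm) /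
      hermitianSquare b.dualBasis (realBasis b)).re := by
  rw [CForm.isStrictlyPositiveVolume_iff b h]
  have h0 := hermitianSquare_dualBasis_ne_zero b
  constructor
  · rintro ⟨c, hc, hc'⟩
    rw [hc', mul_div_cancel_right₀ _ h0]
    exact hc
  · intro hpos
    refine ⟨_, hpos, ?_⟩
    rw [← div_eq_iff h0]
    refine (Complex.conj_eq_iff_re.mp ?_).symm
    rw [map_div₀, ← conj_apply, ← conj_apply, hΘ, isReal_hermitianSquare]

/-! ### Invariance under complex linear isomorphisms -/

section Pullback

variable {V W : Type*} [AddCommGroup V] [Module ℂ V] [AddCommGroup W] [Module ℂ W]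

theorem IsReal.pullback {m : ℕ} {a : CForm W m} (ha : a.IsReal) (L : V →ₗ[ℂ] W) :
    (CForm.pullback L a).IsReal := by
  rw [IsReal, ← pullback_conj, ha]

theorem pullback_mem_ofType {r s : ℕ} (L : V →ₗ[ℂ] W) {a : CForm W (r + s)}
    (ha : a ∈ ofType W r s) : pullback L a ∈ ofType V r s := by
  induction ha using Submodule.span_induction with
  | mem a h =>
    obtain ⟨γ, δ, rfl⟩ := h
    refine Submodule.subset_span ⟨fun i ↦ γ i ∘ₗ L, fun i ↦ δ i ∘ₗ L, ?_⟩
    rw [pullback_wedge, pullback_conj, pullback_decomposable, pullback_decomposable]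
  | zero => exact zero_mem (ofType V r s)
  | add a b _ _ ha hb => exact add_mem ha hb
  | smul c a _ ha => rw [pullback_smul]; exact Submodule.smul_mem _ c ha

theorem IsStrictlyPositiveVolume.pullback {m : ℕ} {Θ : CForm W m}
    (h : IsStrictlyPositiveVolume Θ) (L : V ≃ₗ[ℂ] W) :
    IsStrictlyPositiveVolume (CForm.pullback (L : V →ₗ[ℂ] W) Θ) := by
  obtain ⟨n, rfl, β, c, hc, rfl⟩ := h
  refine ⟨n, rfl, β.map L.dualMap, c, hc, ?_⟩
  have h := pullback_hermitianSquare (L : V →ₗ[ℂ] W) β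
  have hβ : ⇑(β.map L.dualMap) = fun i ↦ β i ∘ₗ (L : V →ₗ[ℂ] W) := by
    ext i v; simp
  have h2 := congrArg ((c : ℂ) • ·) h
  simp only [hermitianSquare, ← pullback_smul, smul_smul] at h2
  rw [hβ]
  exact h2

theorem IsTransverse.pullback {p : ℕ} {a : CForm W (p + p)} (h : a.IsTransverse)
    (L : V ≃ₗ[ℂ] W) : (CForm.pullback (L : V →ₗ[ℂ] W) a).IsTransverse := by
  refine ⟨pullback_mem_ofType _ h.1, fun q hq γ hγ ↦ ?_⟩
  set γ' : Fin q → Module.Dual ℂ W := fun i ↦ γ i ∘ₗ (L.symm : W →ₗ[ℂ] V) with hγ'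
  have hγγ' : (fun i ↦ γ' i ∘ₗ (L : V →ₗ[ℂ] W)) = γ := by
    ext i v; simp [hγ']
  have hne : decomposable γ' ≠ 0 := by
    intro h0
    apply hγ
    rw [← hγγ', ← pullback_decomposable, h0]
    rfl
  have := (h.2 q (hq.trans L.finrank_eq) γ' hne).pullback L
  rw [pullback_wedge] at this
  have h2 := pullback_hermitianSquare (L : V →ₗ[ℂ] W) γ'
  rw [hγγ'] at h2
  change IsStrictlyPositiveVolume (wedge _ (hermitianSquare γ))
  rw [← h2]
  exact this

end Pullback

/-! ### Openness of transversality on a Hermitian vector space -/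

section Hermitian

variable {n : ℕ}

/-- The linear functionals `⟨wᵢ, ·⟩` of a family of vectors of `ℂ^n`. -/
def innerDual {q : ℕ} (w : Fin q → EuclideanSpace ℂ (Fin n)) :
    Fin q → Module.Dual ℂ (EuclideanSpace ℂ (Fin n)) :=
  fun i ↦ innerₛₗ ℂ (w i)

@[simp]
theorem innerDual_apply {q : ℕ} (w : Fin q → EuclideanSpace ℂ (Fin n)) (i : Fin q)
    (v : EuclideanSpace ℂ (Fin n)) : innerDual w i v = inner ℂ (w i) v :=
  rfl

theorem decomposable_innerDual_ne_zero {q : ℕ} {w : Fin q → EuclideanSpace ℂ (Fin n)}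
    (hw : Orthonormal ℂ w) : decomposable (innerDual w) ≠ 0 := by
  intro h
  have h1 : decomposable (innerDual w) w = 1 := by
    rw [decomposable_apply, ← Matrix.det_one (n := Fin q)]
    congr 1
    ext i j
    simp [orthonormal_iff_ite.mp hw, Matrix.one_apply]
  rw [h] at h1
  exact zero_ne_one h1

/-- A nonzero decomposable form is a multiple of one made from an orthonormal family, since it is
determined up to a factor by the span of its functionals. -/
theorem exists_orthonormal_decomposable_eq_smul {q : ℕ}
    {γ : Fin q → Module.Dual ℂ (EuclideanSpace ℂ (Fin n))} (hγ : decomposable γ ≠ 0) :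
    ∃ (w : Fin q → EuclideanSpace ℂ (Fin n)) (z : ℂ), Orthonormal ℂ w ∧ z ≠ 0 ∧
      decomposable γ = z • decomposable (innerDual w) := by
  let D := InnerProductSpace.toDual ℂ (EuclideanSpace ℂ (Fin n))
  let u : Fin q → EuclideanSpace ℂ (Fin n) := fun i ↦ D.symm (LinearMap.toContinuousLinearMap (γ i))
  have hu : γ = innerDual u := by
    ext i v
    simp [u, D]
  have hli : LinearIndependent ℂ u := by
    have h := linearIndependent_of_decomposable_ne_zero hγ
    rw [Fintype.linearIndependent_iff] at h ⊢
    intro g hg i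
    have := h (fun i ↦ (starRingEnd ℂ) (g i)) (by
      ext v
      have h2 := congrArg (fun x ↦ inner ℂ x v) hg
      simpa [hu, sum_inner, inner_smul_left, mul_comm] using h2) i
    simpa using this
  let S := Submodule.span ℂ (Set.range u)
  have hS : Module.finrank ℂ S = q := by
    simpa using finrank_span_eq_card hli
  let e : OrthonormalBasis (Fin q) ℂ S := (stdOrthonormalBasis ℂ S).reindex (finCongr hS)
  let w : Fin q → EuclideanSpace ℂ (Fin n) := fun i ↦ e i
  have hw : Orthonormal ℂ w := e.orthonormal.comp_linearIsometry S.subtypeₗᵢ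
  let A : Matrix (Fin q) (Fin q) ℂ := Matrix.of fun i j ↦ inner ℂ (u i) (w j)
  have hA : ∀ i, γ i = ∑ j, A i j • innerDual w j := by
    intro i
    have h1 := congrArg (Subtype.val)
      (e.sum_repr' ⟨u i, Submodule.subset_span (Set.mem_range_self i)⟩)
    rw [hu]
    ext v
    have h2 : u i = ∑ j, inner ℂ (w j) (u i) • w j := by
      rw [Submodule.coe_sum] at h1
      simpa [w] using h1.symm
    simp only [innerDual_apply, LinearMap.sum_apply, LinearMap.smul_apply, smul_eq_mul]
    conv_lhs => rw [h2]
    simp only [sum_inner, inner_smul_left, inner_conj_symm, A, Matrix.of_apply]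
  have hdec := decomposable_eq_det_smul hA
  refine ⟨w, A.det, hw, fun h0 ↦ hγ ?_, hdec⟩
  rw [hdec, h0, zero_smul]

theorem isCompact_setOf_orthonormal (n q : ℕ) :
    IsCompact {w : Fin q → EuclideanSpace ℂ (Fin n) | Orthonormal ℂ w} := by
  refine Metric.isCompact_of_isClosed_isBounded ?_ ?_
  · simp only [orthonormal_iff_ite, Set.ofPred_forall]
    refine isClosed_iInter fun i ↦ isClosed_iInter fun j ↦ isClosed_eq ?_ continuous_const
    fun_prop
  · refine (Metric.isBounded_closedBall (x := 0) (r := 1)).subset fun w hw ↦ ?_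
    rw [mem_closedBall_zero_iff, pi_norm_le_iff_of_nonneg zero_le_one]
    exact fun i ↦ (hw.1 i).le

theorem continuous_hermitianSquare_innerDual_apply (q : ℕ)
    (v : Fin (q + q) → EuclideanSpace ℂ (Fin n)) :
    Continuous fun w : Fin q → EuclideanSpace ℂ (Fin n) ↦ hermitianSquare (innerDual w) v := by
  have h : ∀ v : Fin q → EuclideanSpace ℂ (Fin n),
      Continuous fun w : Fin q → EuclideanSpace ℂ (Fin n) ↦ decomposable (innerDual w) v := by
    intro v
    simp only [decomposable_apply, innerDual_apply]
    refine Continuous.matrix_det (continuous_matrix fun i j ↦ ?_)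
    simp only [Matrix.of_apply]
    fun_prop
  simp only [hermitianSquare, AlternatingMap.smul_apply, smul_eq_mul]
  exact continuous_const.mul (continuous_wedge_apply h
    (b := fun w ↦ conj (decomposable (innerDual w)))
    (fun v ↦ Complex.continuous_conj.comp (h v)) v)

/-- The ratio of `a ∧ σ_q τ ∧ τ̄` to the standard volume form, where `τ` is the decomposable form
`⟨w₁, ·⟩ ∧ ⋯ ∧ ⟨w_q, ·⟩`. -/
def transversalityRatio {p q : ℕ} (h : p + q = n) (a : CForm (EuclideanSpace ℂ (Fin n)) (p + p))
    (w : Fin q → EuclideanSpace ℂ (Fin n)) : ℂ :=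
  let b := (EuclideanSpace.basisFun (Fin n) ℂ).toBasis
  wedge a (hermitianSquare (innerDual w))
    (realBasis b ∘ finCongr (by omega : p + p + (q + q) = n + n)) /
    hermitianSquare b.dualBasis (realBasis b)

/-- It suffices to test transversality on orthonormal families. -/
theorem isTransverse_iff_forall_orthonormal {p q : ℕ} (h : p + q = n)
    {a : CForm (EuclideanSpace ℂ (Fin n)) (p + p)} (ha : a ∈ ofType _ p p) (hreal : a.IsReal) :
    a.IsTransverse ↔ ∀ w : Fin q → EuclideanSpace ℂ (Fin n), Orthonormal ℂ w →
      0 < (transversalityRatio h a w).re := by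
  have hb : n + n = p + p + (q + q) := by omega
  set b := (EuclideanSpace.basisFun (Fin n) ℂ).toBasis
  have key (γ : Fin q → Module.Dual ℂ (EuclideanSpace ℂ (Fin n))) :=
    (hreal.wedge (isReal_hermitianSquare γ)).isStrictlyPositiveVolume_iff b hb
  constructor
  · intro hT w hw
    exact (key _).mp (hT.2 q (by simpa using h) _ (decomposable_innerDual_ne_zero hw))
  · refine fun hw ↦ ⟨ha, fun q' hq' γ hγ ↦ ?_⟩
    obtain rfl : q' = q := by simp at hq'; omega
    obtain ⟨w, z, hwo, hz, hγw⟩ := exists_orthonormal_decomposable_eq_smul hγ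
    refine (key γ).mpr ?_
    rw [hermitianSquare_eq_normSq_smul hγw, wedge_smul, AlternatingMap.smul_apply, smul_eq_mul,
      mul_div_assoc, Complex.re_ofReal_mul]
    exact mul_pos (Complex.normSq_pos.mpr hz) (hw w hwo)

/-- Transversality is an open condition in continuous families of real `(p, p)`-forms, because it
is a strict inequality on the compact set of orthonormal families. -/
theorem IsTransverse.eventually {X : Type*} [TopologicalSpace X] {p : ℕ} (hp : p ≤ n)
    {a : X → CForm (EuclideanSpace ℂ (Fin n)) (p + p)} (hcont : ∀ v, Continuous fun x ↦ a x v)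
    (htype : ∀ x, a x ∈ ofType _ p p) (hreal : ∀ x, (a x).IsReal) {x₀ : X}
    (h : (a x₀).IsTransverse) : ∀ᶠ x in 𝓝 x₀, (a x).IsTransverse := by
  obtain ⟨q, hq⟩ := Nat.exists_eq_add_of_le hp
  have hcont' : Continuous fun y : X × (Fin q → EuclideanSpace ℂ (Fin n)) ↦
      (transversalityRatio hq.symm (a y.1) y.2).re :=
    Complex.continuous_re.comp <| Continuous.div_const (continuous_wedge_apply
      (fun v ↦ (hcont v).comp continuous_fst)
      (fun v ↦ (continuous_hermitianSquare_innerDual_apply q v).comp continuous_snd) _) _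
  simp only [isTransverse_iff_forall_orthonormal hq.symm (htype _) (hreal _)] at h ⊢
  refine (isCompact_setOf_orthonormal n q).eventually_forall_of_forall_eventually fun w hw ↦ ?_
  exact hcont'.continuousAt.eventually (lt_mem_nhds (h w hw))

end Hermitian

end CForm

/-! ### Fibers near a given one -/

namespace DifferentiableFamily

variable {n k m : ℕ} {𝒳 : Type*} [TopologicalSpace 𝒳] [ChartedSpace (EuclideanSpace ℝ (Fin m)) 𝒳]
  {B : Set (EuclideanSpace ℝ (Fin k))}

/-- The projection is an open map, since it is a submersion: in a chart of `𝒳` this is the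
implicit function theorem. -/
theorem map_proj_nhds (F : DifferentiableFamily n k m 𝒳 B) (x : 𝒳) :
    Filter.map F.proj (𝓝 x) = 𝓝 (F.proj x) := by
  set φ := chartAt (EuclideanSpace ℝ (Fin m)) x with hφ
  set g : EuclideanSpace ℝ (Fin m) → EuclideanSpace ℝ (Fin k) := F.proj ∘ φ.symm with hg
  have hC : ContDiffAt ℝ ∞ g (φ x) := by
    have := ((contMDiffAt_iff (I := 𝓡 m) (I' := 𝓡 k)).mp (F.contMDiff_proj x)).2
    simpa [contDiffWithinAt_univ, hg, Function.comp_def, chartAt_self_eq] using this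
  have hd : HasStrictFDerivAt g (fderiv ℝ g (φ x)) (φ x) :=
    hC.hasStrictFDerivAt (by simp)
  have hsurj : (fderiv ℝ g (φ x)).range = ⊤ := by
    have hm := (F.contMDiff_proj.mdifferentiable (by simp) x).mfderiv
    have hg' : writtenInExtChartAt (𝓡 m) (𝓡 k) x F.proj = g := by
      ext1 y
      simp [writtenInExtChartAt, hg, hφ, chartAt_self_eq]
    rw [hg', ModelWithCorners.range_eq_univ, fderivWithin_univ] at hm
    exact LinearMap.range_eq_top.mpr (hm ▸ F.submersion x)
  have hmap := hd.map_nhds_eq_of_surj hsurj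
  have hsymm : Filter.map φ.symm (𝓝 (φ x)) = 𝓝 x :=
    φ.symm_map_nhds_eq (mem_chart_source _ x)
  rw [hg, ← Filter.map_map, hsymm] at hmap
  simpa [hφ] using hmap

/-- Since the fibers are compact and connected, those near `X_{t₀}` are contained in any given
neighbourhood of it: they meet a relatively compact neighbourhood `V` of `X_{t₀}`, because `π` is
open, but do not meet its frontier, whose image under `π` is a closed set not containing `t₀`. -/
theorem eventually_fiber_subset [T2Space 𝒳] (F : DifferentiableFamily n k m 𝒳 B)
    {t₀ : EuclideanSpace ℝ (Fin k)} (ht₀ : t₀ ∈ B) {U : Set 𝒳} (hU : IsOpen U)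
    (hsub : F.proj ⁻¹' {t₀} ⊆ U) : ∀ᶠ t in 𝓝 t₀, t ∈ B → F.proj ⁻¹' {t} ⊆ U := by
  have : LocallyCompactSpace 𝒳 := ChartedSpace.locallyCompactSpace (EuclideanSpace ℝ (Fin m)) 𝒳
  obtain ⟨V, hV, hKV, hVU, hVc⟩ :=
    exists_open_between_and_isCompact_closure (F.isCompact_fiber t₀ ht₀) hU hsub
  have hcont : Continuous F.proj := F.contMDiff_proj.continuous
  have hfr : IsCompact (F.proj '' frontier V) :=
    (hVc.of_isClosed_subset isClosed_frontier frontier_subset_closure).image hcont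
  have h1 : ∀ᶠ t in 𝓝 t₀, t ∉ F.proj '' frontier V := by
    refine hfr.isClosed.isOpen_compl.mem_nhds ?_
    rintro ⟨x, hx, hxt⟩
    exact (hV.frontier_eq ▸ hx).2 (hKV hxt)
  have h2 : ∀ᶠ t in 𝓝 t₀, t ∈ F.proj '' V := by
    obtain ⟨x, rfl⟩ : t₀ ∈ Set.range F.proj := by rwa [F.range_proj]
    rw [← F.map_proj_nhds x]
    exact Filter.image_mem_map (hV.mem_nhds (hKV rfl))
  filter_upwards [h1, h2] with t ht1 ht2 htB
  refine Set.Subset.trans ?_ (subset_closure.trans hVU)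
  refine (F.isConnected_fiber t htB).isPreconnected.subset_left_of_subset_union hV
    isClosed_closure.isOpen_compl (disjoint_compl_right.mono_left subset_closure) ?_ ?_
  · intro x hx
    by_cases hxV : x ∈ V
    · exact .inl hxV
    · exact .inr fun hxc ↦ ht1 ⟨x, hV.frontier_eq ▸ ⟨hxc, hxV⟩, hx⟩
  · obtain ⟨x, hxV, hxt⟩ := ht2
    exact ⟨x, hxt, hxV⟩

theorem bijective_dcoord (F : DifferentiableFamily n k m 𝒳 B) (j : ℕ)
    {t : EuclideanSpace ℝ (Fin k)} (x : F.Fiber t) (hx : (x : 𝒳) ∈ F.cover j) :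
    Function.Bijective (F.dcoord j x) := by
  obtain ⟨e, he, hsrc, heq⟩ := F.coord_fiber t j ⟨x, hx, x.2⟩
  have hxe : x ∈ e.source := hsrc ▸ hx
  have hdiff : e.MDifferentiable 𝓘(ℂ, EuclideanSpace ℂ (Fin n)) 𝓘(ℂ, EuclideanSpace ℂ (Fin n)) :=
    ⟨(contMDiffOn_of_mem_maximalAtlas he).mdifferentiableOn (by simp),
      (contMDiffOn_symm_of_mem_maximalAtlas he).mdifferentiableOn (by simp)⟩
  have hev : (fun y : F.Fiber t ↦ F.coord j (y : 𝒳)) =ᶠ[𝓝 x] e := by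
    filter_upwards [e.open_source.mem_nhds hxe] with y hy using (heq y hy).symm
  have := hdiff.mfderiv_bijective hxe
  rw [← hev.mfderiv_eq] at this
  exact this

end DifferentiableFamily

end

theorem proposition4 {n k m p : ℕ} (hp : p ≤ n)
    {𝒳 : Type*} [TopologicalSpace 𝒳] [T2Space 𝒳] [SecondCountableTopology 𝒳]
    [ChartedSpace (EuclideanSpace ℝ (Fin m)) 𝒳] [IsManifold (𝓡 m) ∞ 𝒳]
    {B : Set (EuclideanSpace ℝ (Fin k))} (F : DifferentiableFamily n k m 𝒳 B)
    {t₀ : EuclideanSpace ℝ (Fin k)} (ht₀ : t₀ ∈ B)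
    (Ω : ∀ t, FormField n (F.Fiber t) (p + p))
    (hΩ : ∀ t ∈ B, IsRealPPForm (Ω t)) (hsmooth : F.IsSmoothFamily Ω)
    (htrans : IsTransverseForm (Ω t₀)) :
    ∃ ε > 0, ∀ t ∈ B, dist t t₀ < ε → IsTransverseForm (Ω t) := by
  -- The points of `𝒳` at which the form on the fiber through the point is transverse.
  set T : Set 𝒳 := {x | (Ω (F.proj x) ⟨x, rfl⟩).IsTransverse} with hT
  have hmem : ∀ {t} (x : F.Fiber t), (x : 𝒳) ∈ T ↔ (Ω t x).IsTransverse := by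
    rintro _ ⟨x, rfl⟩
    rfl
  have hnhds : ∀ x ∈ F.proj ⁻¹' {t₀}, T ∈ 𝓝 x := by
    intro x hx
    obtain ⟨j, hj⟩ := Set.mem_iUnion.mp (F.iUnion_cover ▸ Set.mem_univ x)
    -- The coefficients `a` of the forms and the forms themselves are pull-backs of each other along
    -- the isomorphisms `dζ_j`, which gives `a` the type, reality and transversality of `Ω`.
    obtain ⟨a, ha, hΩa⟩ := hsmooth j
    let L (y : 𝒳) (hy : y ∈ F.cover j) :=
      LinearEquiv.ofBijective (F.dcoord j (t := F.proj y) ⟨y, rfl⟩) (F.bijective_dcoord j _ hy)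
    have hpull : ∀ y hy, Ω (F.proj y) ⟨y, rfl⟩ = CForm.pullback (L y hy).toLinearMap (a y) :=
      fun y hy ↦ hΩa _ ⟨y, rfl⟩ hy
    have hpush : ∀ y hy,
        a y = CForm.pullback (L y hy).symm.toLinearMap (Ω (F.proj y) ⟨y, rfl⟩) := by
      intro y hy
      rw [hpull y hy]
      ext v
      simp
    have hB : ∀ y, F.proj y ∈ B := fun y ↦ F.range_proj.subset (Set.mem_range_self y)
    have hxT : (Ω (F.proj x) ⟨x, rfl⟩).IsTransverse := (hmem ⟨x, hx⟩).mpr (htrans ⟨x, hx⟩)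
    have h0 : (a x).IsTransverse := by
      rw [hpush x hj]
      exact hxT.pullback (L x hj).symm
    have hev := CForm.IsTransverse.eventually (X := F.cover j) hp (a := fun y ↦ a y)
      (fun v ↦ continuousOn_iff_continuous_domRestrict.mp (ha v).continuousOn)
      (fun y ↦ by
        rw [hpush y y.2]
        exact CForm.pullback_mem_ofType _ (hΩ _ (hB y) _).1)
      (fun y ↦ by
        rw [hpush y y.2]
        exact (hΩ _ (hB y) _).2.pullback _) (x₀ := ⟨x, hj⟩) h0
    rw [(F.isOpen_cover j).isOpenEmbedding_subtypeVal.map_nhds_eq ⟨x, hj⟩ |>.symm]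
    refine Filter.mem_map.mpr ?_
    filter_upwards [hev] with y hy
    change (Ω (F.proj y) ⟨y, rfl⟩).IsTransverse
    rw [hpull y y.2]
    exact hy.pullback (L y y.2)
  obtain ⟨ε, hε, h⟩ := Metric.eventually_nhds_iff.mp
    (F.eventually_fiber_subset ht₀ isOpen_interior
      fun x hx ↦ mem_interior_iff_mem_nhds.mpr (hnhds x hx))
  exact ⟨ε, hε, fun t ht hd x ↦ (hmem x).mp (interior_subset (h hd ht x.2))⟩
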